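/- Corollary 4.5. Let $\Gamma=(V,E)$ be a finite directed multigraph (loops and parallel edges allowed) whose edge weights $\mathrm{wt}(e)$, $e\in E$, are distinct indeterminates, and let $\mathbb Z[E]$ be the polynomial ring in these indeterminates. For a vertex $v$, an arborescence rooted at $v$ is a spanning tree directed towards $v$, and $A_v(\Gamma)$ is the sum, over all arborescences $T$ rooted at $v$, of $\mathrm{wt}(T)=\prod_{e\in T}\mathrm{wt}(e)$. Let $\pi:\tilde\Gamma\to\Gamma$ be a regular $2$-fold cover by a finite graph: $\pi$ is a weight-preserving morphism of directed multigraphs which maps the outgoing (respectively incoming) edges of each vertex $\tilde u$ bijectively to the outgoing (respectively incoming) edges of $\pi(\tilde u)$, all fibres over vertices and edges have $2$ elements, and the automorphisms of $\tilde\Gamma$ commuting with $\pi$ act transitively on each vertex fibre. Let $\tilde v$ be a vertex of $\tilde\Gamma$ and $v=\pi(\tilde v)$. Then the ratio $A_{\tilde v}(\tilde\Gamma)/A_v(\Gamma)$ is a polynomial in $\mathbb Z[E]$ all of whose nonzero coefficients are positive; that is, there is such a polynomial $P$ with $A_{\tilde v}(\tilde\Gamma)=P\cdot A_v(\Gamma)$,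 so that $P$ is the ratio whenever $A_v(\Gamma)\neq 0$. Moreover, there are voltages $\nu:E\to\{1,-1\}\cong\mathbb Z/2\mathbb Z$ for which $\tilde\Gamma$ is isomorphic over $\Gamma$ to the derived graph, which has vertex set $V\times\{1,-1\}$ and, for each edge $e$ of $\Gamma$ from $u$ to $w$ and each $h\in\{1,-1\}$, one edge from $(u,h)$ to $(w,\nu(e)h)$ lying over $e$. For every such $\nu$, $$P=\sum_{\gamma\in\mathcal N(\Gamma)}2^{\#C(\gamma)-1}\,\mathrm{wt}(\gamma).$$ Here a vector field $\gamma$ is a set of edges containing exactly one outgoing edge of each vertex, $\mathrm{wt}(\gamma)=\prod_{e\in\gamma}\mathrm{wt}(e)$, $C(\gamma)$ is the set of directed cycles in $\gamma$, and $\mathcal N(\Gamma)$ is the set of negative vector fields, i.e. those $\gamma$ with $\prod_{e\in c}\nu(e)=-1$ for every $c\in C(\gamma)$. -/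

import Mathlib

/-- An edge-weighted directed multigraph (loops and parallel edges allowed) with vertex set `V`,
edge set `E` and edge weights in `R`. -/
structure WDigraph (V E R : Type*) where
  /-- source of an edge -/
  src : E → V
  /-- target of an edge -/
  tgt : E → V
  /-- weight of an edge -/
  wt : E → R

namespace WDigraph

section Basic

variable {V E R : Type*} (Γ : WDigraph V E R)

/-- `Γ.IsWalk u p v`: the list of edges `p` is a directed walk from `u` to `v`. -/
def IsWalk : V → List E → V → Prop
  | u, [], v => u = v
  | u, e :: p, v => Γ.src e = u ∧ IsWalk (Γ.tgt e) p v

/-- The set of edges `T` is an arborescence rooted at `v`: for every vertex `w` there is exactly one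
directed walk from `w` to `v` in `T`. (Uniqueness is among all walks, so `T` has no edge leaving
`v`, one edge leaving each other vertex, and no cycle: `T` is a spanning tree directed
towards `v`.) -/
def IsArborescence (T : Finset E) (v : V) : Prop :=
  ∀ w : V, ∃! p : List E, Γ.IsWalk w p v ∧ ∀ e ∈ p, e ∈ T

open Classical in
/-- `A_v(Γ)`, the sum of the weights of all arborescences of `Γ` rooted at `v`. -/
noncomputable def arbSum [Fintype E] [CommRing R] (v : V) : R :=
  ∑ T : Finset E with Γ.IsArborescence T v, ∏ e ∈ T, Γ.wt e

/-- The set of edges `γ` is a vector field: every vertex has outdegree one in `γ`. -/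
def IsVectorField (γ : Finset E) : Prop :=
  ∀ v : V, ∃! e : E, e ∈ γ ∧ Γ.src e = v

/-- `c` is the edge set of a directed cycle: a nonempty closed walk without repeated vertices. -/
def IsCycle (c : Finset E) : Prop :=
  ∃ (u : V) (p : List E), p ≠ [] ∧ Γ.IsWalk u p u ∧ (p.map Γ.src).Nodup ∧ ∀ e, e ∈ c ↔ e ∈ p

open Classical in
/-- `C(γ)`, the set of cycles contained in `γ`, as edge sets. -/
noncomputable def cycles (γ : Finset E) : Finset (Finset E) :=
  γ.powerset.filter Γ.IsCycle

/-- A vector field of a signed graph (voltages in `ℤ/2ℤ = {1, -1}`) is negative if each of its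
cycles has voltage `-1`. -/
def IsNegativeVectorField (ν : E → ℤˣ) (γ : Finset E) : Prop :=
  Γ.IsVectorField γ ∧ ∀ c ∈ Γ.cycles γ, ∏ e ∈ c, ν e = -1

open Classical in
/-- The set of negative vector fields of the signed graph `(Γ, ν)`. -/
noncomputable def negativeVectorFields [Fintype E] (ν : E → ℤˣ) : Finset (Finset E) :=
  Finset.univ.filter (Γ.IsNegativeVectorField ν)

/-- The derived graph of a voltage graph with voltages `ν` in a group `G`: the lift of `e` at `h`
goes from `(src e, h)` to `(tgt e, ν e * h)` and has the weight of `e`. -/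
def derived {G : Type*} [Group G] (ν : E → G) : WDigraph (V × G) (E × G) R where
  src x := (Γ.src x.1, x.2)
  tgt x := (Γ.tgt x.1, ν x.1 * x.2)
  wt x := Γ.wt x.1

end Basic

section Covering

variable {V E V' E' R : Type*}

/-- A covering projection of `Γ` by `Γ'`: a weight preserving morphism of directed multigraphs that
is a local homeomorphism, i.e. maps the edges leaving (entering) each vertex bijectively to the
edges leaving (entering) its image. -/
structure Covering (Γ' : WDigraph V' E' R) (Γ : WDigraph V E R) where
  /-- the projection on vertices -/
  onV : V' → V
  /-- the projection on edges -/
  onE : E' → E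
  src_onE : ∀ e, Γ.src (onE e) = onV (Γ'.src e)
  tgt_onE : ∀ e, Γ.tgt (onE e) = onV (Γ'.tgt e)
  wt_onE : ∀ e, Γ'.wt e = Γ.wt (onE e)
  bijOn_src : ∀ x, Set.BijOn onE {e | Γ'.src e = x} {e | Γ.src e = onV x}
  bijOn_tgt : ∀ x, Set.BijOn onE {e | Γ'.tgt e = x} {e | Γ.tgt e = onV x}

namespace Covering

variable {Γ' : WDigraph V' E' R} {Γ : WDigraph V E R} (π : Covering Γ' Γ)

/-- The covering is `k`-fold: all fibres over vertices and over edges have exactly `k` elements. -/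
def IsFold (k : ℕ) : Prop :=
  (∀ v, (π.onV ⁻¹' {v}).encard = k) ∧ ∀ e, (π.onE ⁻¹' {e}).encard = k

/-- A deck transformation: an automorphism of the covering graph commuting with the projection. -/
structure Deck where
  /-- the action on vertices -/
  permV : V' ≃ V'
  /-- the action on edges -/
  permE : E' ≃ E'
  src_permE : ∀ e, Γ'.src (permE e) = permV (Γ'.src e)
  tgt_permE : ∀ e, Γ'.tgt (permE e) = permV (Γ'.tgt e)
  onV_permV : ∀ x, π.onV (permV x) = π.onV x
  onE_permE : ∀ e, π.onE (permE e) = π.onE e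

/-- The covering is regular: deck transformations act transitively on each vertex fibre. -/
def IsRegular : Prop :=
  ∀ x y, π.onV x = π.onV y → ∃ d : π.Deck, d.permV x = y

/-- The covering is the derived cover of `Γ` for the voltages `ν`, up to an isomorphism over `Γ`. -/
def IsDerivedFrom {G : Type*} [Group G] (ν : E → G) : Prop :=
  ∃ (f : V' ≃ V × G) (g : E' ≃ E × G),
    (∀ x, (f x).1 = π.onV x) ∧ (∀ e, (g e).1 = π.onE e) ∧
    (∀ e, (Γ.derived ν).src (g e) = f (Γ'.src e)) ∧
    (∀ e, (Γ.derived ν).tgt (g e) = f (Γ'.tgt e))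

end Covering

end Covering

end WDigraph

/-! Both sides are coefficients of determinants. For signs ν on the edges let L_ν be the signed
Laplacian, whose row u is the sum of wt(e)(δ_u - ν(e)δ_{tgt e}) over the edges e leaving u.
Multilinear expansion in the rows (`det_rootedLaplacian`) reduces to functional digraphs with one
edge out of each vertex, where det(1 - N) is the product of 1 - ν(c) over the cycles c. Hence det
L_ν = 2P_ν, with P_ν the sum over negative vector fields (`det_signedLaplacian`). With trivial signs
and row v replaced by a unit vector, the same expansion gives A_v (`det_rootedLaplacian_singleton`).

In the derived graph the two sheets give the Laplacian the block form (A B; B A), with A + B = L_1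
and A - B = L_ν. Adding t to the diagonal entries at both lifts of v turns its determinant into
det(L_1 + tE_v) det(L_ν + tE_v). Since det L_1 = 0 and the two lifts have equal arborescence sums,
the coefficients of t give 2A_ṽ = A_v · 2P_ν (`arbSum_derived`).

Every 2-fold cover comes from a signing (`exists_isDerivedFrom`). Two signings of it differ by
switching (`exists_switching`), which conjugates L_ν by a diagonal matrix of signs, so P_ν depends
only on the cover, even where A_v = 0. -/

namespace Matrix

/-! ### Determinants of weighted self-maps -/

variable {V R : Type*} [Fintype V] [DecidableEq V]

/-- The matrix of the self-map `f` with weights `ε`: row `u` has the entry `ε u` in column `f u`. -/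
def ofSelfMap [Zero R] (f : V → V) (ε : V → R) : Matrix V V R :=
  fun u w => if f u = w then ε u else 0

theorem ofSelfMap_pow_apply [CommRing R] (f : V → V) (ε : V → R) (j : ℕ) (u w : V) :
    (ofSelfMap f ε ^ j) u w =
      if f^[j] u = w then ∏ i ∈ Finset.range j, ε (f^[i] u) else 0 := by
  induction j generalizing w with
  | zero =>
    simp only [pow_zero, Matrix.one_apply, Function.iterate_zero, id_eq, Finset.range_zero,
      Finset.prod_empty]
    split_ifs with h <;> simp [h]
  | succ j ih =>
    rw [pow_succ, Matrix.mul_apply]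
    simp only [ih, ite_mul, zero_mul, Finset.sum_ite_eq, Finset.mem_univ, if_true]
    rw [Finset.prod_range_succ, Function.iterate_succ_apply']
    simp [ofSelfMap]

/-- The characteristic polynomial differs from a power of X by a nilpotent polynomial, which
vanishes over ℤ; evaluate at 1. -/
theorem det_one_sub_of_isNilpotent {N : Matrix V V ℤ} (h : IsNilpotent N) :
    (1 - N).det = 1 := by
  have h1 := (Matrix.isNilpotent_charpoly_sub_pow_of_isNilpotent h).eq_zero
  have h2 := congrArg (Polynomial.eval 1) h1
  simpa [Matrix.eval_charpoly, sub_eq_zero] using h2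

theorem det_one_sub_ofSelfMap_eq_one {f : V → V} {ε : V → ℤ}
    (h : ∀ u, ∃ j, ε (f^[j] u) = 0) : (1 - ofSelfMap f ε).det = 1 := by
  choose j hj using h
  apply det_one_sub_of_isNilpotent
  refine ⟨Finset.univ.sup j + 1, ?_⟩
  ext u w
  rw [ofSelfMap_pow_apply, Matrix.zero_apply, ite_eq_right_iff]
  intro _
  exact Finset.prod_eq_zero (Finset.mem_range.2
    (Nat.lt_succ_of_le (Finset.le_sup (f := j) (Finset.mem_univ u)))) (hj u)

theorem det_one_sub_ofSelfMap_eq_zero {f : V → V} {ε : V → ℤ} {u : V}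
    (hu : u ∈ Function.periodicPts f)
    (h : ∏ i ∈ Finset.range (Function.minimalPeriod f u), ε (f^[i] u) = 1) :
    (1 - ofSelfMap f ε).det = 0 := by
  set k := Function.minimalPeriod f u with hk
  have hk0 : 0 < k := Function.minimalPeriod_pos_of_mem_periodicPts hu
  rw [← Matrix.exists_vecMul_eq_zero_iff]
  -- Row u of 1 + N + ⋯ + N^(k-1) is a left null vector: this sum times 1 - N is 1 - N^k, and row u
  -- of N^k is that of the identity. Its entry at u is 1 because k is the minimal period.
  refine ⟨fun w => (∑ j ∈ Finset.range k, ofSelfMap f ε ^ j) u w, ?_, ?_⟩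
  · intro h0
    have := congrFun h0 u
    simp only [Matrix.sum_apply, ofSelfMap_pow_apply, Pi.zero_apply] at this
    rw [Finset.sum_eq_single_of_mem 0 (Finset.mem_range.2 hk0)] at this
    · simp at this
    · intro j hj hj0
      rw [if_neg]
      intro hp
      exact Function.not_isPeriodicPt_of_pos_of_lt_minimalPeriod hj0 (Finset.mem_range.1 hj) hp
  · have h1 := geom_sum_mul_neg (ofSelfMap f ε) k
    ext w
    have h2 := congrFun (congrFun h1 u) w
    have h3 : f^[k] u = u := Function.iterate_minimalPeriod
    rw [Matrix.sub_apply, ofSelfMap_pow_apply, h, h3, Matrix.one_apply, sub_self] at h2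
    exact h2

end Matrix

/-! ### Periodic orbits of a self-map -/

namespace Function

variable {V : Type*}

theorem iterate_mem_periodicPts {f : V → V} {u : V} (hu : u ∈ periodicPts f) (i : ℕ) :
    f^[i] u ∈ periodicPts f := by
  obtain ⟨n, hn, h⟩ := hu
  exact ⟨n, hn, h.apply_iterate i⟩

theorem exists_iterate_mem_periodicPts [Finite V] (f : V → V) (u : V) : ∃ i, f^[i] u ∈ periodicPts f := by
  obtain ⟨i, j, hij, h⟩ : ∃ i j : ℕ, i < j ∧ f^[i] u = f^[j] u := by
    obtain ⟨i, j, hne, h⟩ := Finite.exists_ne_map_eq_of_infinite fun i : ℕ => f^[i] u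
    rcases lt_or_gt_of_ne hne with hl | hl
    · exact ⟨i, j, hl, h⟩
    · exact ⟨j, i, hl, h.symm⟩
  refine ⟨i, j - i, Nat.sub_pos_of_lt hij, ?_⟩
  rw [IsPeriodicPt, IsFixedPt, ← iterate_add_apply, Nat.sub_add_cancel hij.le, h]

variable [DecidableEq V]

/-- The set of points of the orbit of a periodic point. -/
noncomputable def orbitFinset (f : V → V) (u : V) : Finset V :=
  (Finset.range (minimalPeriod f u)).image fun i => f^[i] u

theorem mem_orbitFinset {f : V → V} {u : V} (hu : u ∈ periodicPts f) {w : V} :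
    w ∈ orbitFinset f u ↔ ∃ i, f^[i] u = w := by
  simp only [orbitFinset, Finset.mem_image, Finset.mem_range]
  constructor
  · rintro ⟨i, -, hi⟩
    exact ⟨i, hi⟩
  · rintro ⟨i, hi⟩
    refine ⟨i % minimalPeriod f u, Nat.mod_lt _ (minimalPeriod_pos_of_mem_periodicPts hu), ?_⟩
    rw [iterate_mod_minimalPeriod_eq, hi]

theorem self_mem_orbitFinset {f : V → V} {u : V} (hu : u ∈ periodicPts f) :
    u ∈ orbitFinset f u :=
  (mem_orbitFinset hu).2 ⟨0, rfl⟩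

theorem orbitFinset_eq_of_mem {f : V → V} {u : V} (hu : u ∈ periodicPts f) {w : V}
    (hw : w ∈ orbitFinset f u) : orbitFinset f w = orbitFinset f u := by
  obtain ⟨i, hi, rfl⟩ : ∃ i < minimalPeriod f u, f^[i] u = w := by
    simpa [orbitFinset] using hw
  ext x
  rw [mem_orbitFinset hu, mem_orbitFinset (iterate_mem_periodicPts hu i)]
  constructor
  · rintro ⟨j, rfl⟩
    exact ⟨j + i, iterate_add_apply _ _ _ _⟩
  · rintro ⟨j, rfl⟩
    refine ⟨j + (minimalPeriod f u - i), ?_⟩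
    rw [← iterate_add_apply, add_assoc, Nat.sub_add_cancel hi.le, iterate_add_apply,
      iterate_minimalPeriod]

theorem prod_orbitFinset {M : Type*} [CommMonoid M] (f : V → V) (u : V) (g : V → M) :
    ∏ w ∈ orbitFinset f u, g w = ∏ i ∈ Finset.range (minimalPeriod f u), g (f^[i] u) := by
  apply Finset.prod_image
  intro i hi j hj h
  exact iterate_injOn_Iio_minimalPeriod (Finset.mem_range.1 hi) (Finset.mem_range.1 hj) h

variable [Fintype V]

open Classical in
/-- The orbits of the periodic points of a self-map. -/
noncomputable def periodicOrbits (f : V → V) : Finset (Finset V) :=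
  (Finset.univ.filter (· ∈ periodicPts f)).image (orbitFinset f)

theorem mem_periodicOrbits {f : V → V} {c : Finset V} :
    c ∈ periodicOrbits f ↔ ∃ u ∈ periodicPts f, orbitFinset f u = c := by
  simp [periodicOrbits]

theorem periodicOrbits_nonempty [Nonempty V] (f : V → V) : (periodicOrbits f).Nonempty := by
  obtain ⟨i, hi⟩ := exists_iterate_mem_periodicPts f (Classical.arbitrary V)
  exact ⟨_, mem_periodicOrbits.2 ⟨_, hi, rfl⟩⟩

end Function

/-! ### Signed self-maps, one orbit at a time -/

namespace Matrix

open Function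

variable {V : Type*} [Fintype V] [DecidableEq V]

theorem det_one_sub_ofSelfMap_eq_zero_of_orbit {f : V → V} {ε : V → ℤ} {c : Finset V}
    (hc : c ∈ periodicOrbits f) (h : ∏ w ∈ c, ε w = 1) : (1 - ofSelfMap f ε).det = 0 := by
  obtain ⟨u, hu, rfl⟩ := mem_periodicOrbits.1 hc
  rw [prod_orbitFinset] at h
  exact det_one_sub_ofSelfMap_eq_zero hu h

/-- Adding up the values at `a` and `-a` of an affine function of the weight `ε u`. -/
theorem det_one_sub_ofSelfMap_add (f : V → V) (ε : V → ℤ) (u : V) :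
    (1 - ofSelfMap f ε).det + (1 - ofSelfMap f (Function.update ε u (-ε u))).det =
      2 * (1 - ofSelfMap f (Function.update ε u 0)).det := by
  set M := 1 - ofSelfMap f (Function.update ε u 0) with hM
  have key : ∀ a : ℤ, 1 - ofSelfMap f (Function.update ε u a) =
      M.updateRow u (M u + a • fun w => if f u = w then -1 else 0) := by
    intro a
    ext x w
    by_cases hx : x = u
    · subst hx
      by_cases hw : f x = w <;> simp [hM, ofSelfMap, hw, sub_eq_add_neg]
    · simp [hM, ofSelfMap, hx]
  have h1 := key (ε u)
  rw [Function.update_eq_self] at h1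
  rw [h1, key, det_updateRow_add, det_updateRow_add, det_updateRow_smul, det_updateRow_smul,
    updateRow_eq_self]
  ring

/-- Zeroing the weight at a point u of an orbit that avoids Z halves the determinant: flipping the
sign at u instead gives that orbit product 1, hence determinant zero, and the value at 0 is the mean
of the two. Once every orbit meets Z, the matrix is nilpotent. -/
theorem det_one_sub_ofSelfMap_eq_two_pow {f : V → V} {ε : V → ℤ}
    (Z : Finset V) (h : ∀ c ∈ periodicOrbits f, Disjoint c Z → ∏ w ∈ c, ε w = -1) :
    (1 - ofSelfMap f (fun u => if u ∈ Z then 0 else ε u)).det =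
      2 ^ ((periodicOrbits f).filter (Disjoint · Z)).card := by
  induction hn : ((periodicOrbits f).filter (Disjoint · Z)).card generalizing Z with
  | zero =>
    rw [pow_zero]
    apply det_one_sub_ofSelfMap_eq_one
    intro u
    obtain ⟨i, hi⟩ := exists_iterate_mem_periodicPts f u
    have hc : orbitFinset f (f^[i] u) ∈ periodicOrbits f := mem_periodicOrbits.2 ⟨_, hi, rfl⟩
    rw [Finset.card_eq_zero, Finset.filter_eq_empty_iff] at hn
    obtain ⟨w, hw, hwZ⟩ := Finset.not_disjoint_iff.1 (hn hc)
    obtain ⟨j, rfl⟩ := (mem_orbitFinset hi).1 hw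
    exact ⟨j + i, by rw [iterate_add_apply, if_pos hwZ]⟩
  | succ n ih =>
    obtain ⟨c, hc⟩ : ((periodicOrbits f).filter (Disjoint · Z)).Nonempty := by
      rw [← Finset.card_pos]; omega
    obtain ⟨hcf, hcZ⟩ := Finset.mem_filter.1 hc
    obtain ⟨u, hu, rfl⟩ := mem_periodicOrbits.1 hcf
    have huc := self_mem_orbitFinset hu
    have huZ : u ∉ Z := fun hZ => Finset.disjoint_left.1 hcZ huc hZ
    have hfilter : (periodicOrbits f).filter (Disjoint · (insert u Z)) =
        ((periodicOrbits f).filter (Disjoint · Z)).erase (orbitFinset f u) := by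
      ext c
      simp only [Finset.mem_filter, Finset.mem_erase, Finset.disjoint_insert_right]
      constructor
      · rintro ⟨h1, h2, h3⟩
        refine ⟨?_, h1, h3⟩
        rintro rfl
        exact h2 huc
      · rintro ⟨h1, h2, h3⟩
        refine ⟨h2, fun h4 => h1 ?_, h3⟩
        obtain ⟨x, hx, rfl⟩ := mem_periodicOrbits.1 h2
        exact (orbitFinset_eq_of_mem hx h4).symm
    have ih' := ih (insert u Z)
      (fun c hc hd => h c hc (Finset.disjoint_insert_right.1 hd).2)
      (by rw [hfilter, Finset.card_erase_of_mem hc, hn, Nat.add_sub_cancel])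
    set δ : V → ℤ := fun u => if u ∈ Z then 0 else ε u with hδ
    have h0 : Function.update δ u 0 = fun w => if w ∈ insert u Z then 0 else ε w := by
      ext w
      by_cases hw : w = u
      · simp [hw]
      · simp [hw, hδ]
    have hflip : (1 - ofSelfMap f (Function.update δ u (-δ u))).det = 0 := by
      apply det_one_sub_ofSelfMap_eq_zero_of_orbit hcf
      have h1 := h _ hcf hcZ
      rw [Finset.prod_update_of_mem huc]
      rw [← Finset.mul_prod_erase _ _ huc] at h1
      have h2 : ∏ x ∈ (orbitFinset f u).erase u, δ x = ∏ x ∈ (orbitFinset f u).erase u, ε x := by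
        refine Finset.prod_congr rfl fun x hx => if_neg ?_
        exact Finset.disjoint_left.1 hcZ (Finset.mem_of_mem_erase hx)
      rw [Finset.sdiff_singleton_eq_erase, h2]
      simp only [hδ, if_neg huZ]
      rw [neg_mul, h1, neg_neg]
    have := det_one_sub_ofSelfMap_add f δ u
    rw [hflip, h0, ih', add_zero] at this
    rw [this, pow_succ, mul_comm]

open Classical in
/-- The determinant of a signed functional digraph. -/
theorem det_one_sub_ofSelfMap_of_sign {f : V → V} {ε : V → ℤ} (hε : ∀ u, ε u = 1 ∨ ε u = -1) :
    (1 - ofSelfMap f ε).det =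
      if ∀ c ∈ periodicOrbits f, ∏ w ∈ c, ε w = -1 then 2 ^ (periodicOrbits f).card else 0 := by
  split_ifs with h
  · have := det_one_sub_ofSelfMap_eq_two_pow (ε := ε) ∅ (fun c hc _ => h c hc)
    simpa using this
  · push Not at h
    obtain ⟨c, hc, hne⟩ := h
    apply det_one_sub_ofSelfMap_eq_zero_of_orbit hc
    have : ∀ s : Finset V, ∏ w ∈ s, ε w = 1 ∨ ∏ w ∈ s, ε w = -1 := by
      intro s
      induction s using Finset.induction_on with
      | empty => simp
      | insert a s ha ih =>
        rw [Finset.prod_insert ha]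
        rcases hε a with h | h <;> rcases ih with h' | h' <;> simp [h, h']
    exact (this c).resolve_right hne

/-- The determinant of a functional digraph with one root, which has weight zero. -/
theorem det_one_sub_ofSelfMap_of_root {f : V → V} {ε : V → ℤ} {v : V} (hv : ε v = 0)
    (hε : ∀ u, u ≠ v → ε u = 1) [Decidable (∀ u, ∃ i, f^[i] u = v)] :
    (1 - ofSelfMap f ε).det = if ∀ u, ∃ i, f^[i] u = v then 1 else 0 := by
  split_ifs with h
  · apply det_one_sub_ofSelfMap_eq_one
    intro u
    obtain ⟨i, hi⟩ := h u
    exact ⟨i, by rw [hi, hv]⟩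
  · push Not at h
    obtain ⟨u, hu⟩ := h
    obtain ⟨i, hi⟩ := exists_iterate_mem_periodicPts f u
    apply det_one_sub_ofSelfMap_eq_zero hi
    apply Finset.prod_eq_one
    intro j _
    apply hε
    rw [← iterate_add_apply]
    exact hu _

end Matrix

/-! ### Expanding Laplacian determinants over edge sets -/

namespace WDigraph

open Matrix Function

section Expansion

variable {V E R : Type*} [DecidableEq V] (Γ : WDigraph V E R)

/-- The set of edges `T` has no edge leaving a vertex of `Z` and one edge leaving any other
vertex. -/
def IsRootedField (Z : Finset V) (T : Finset E) : Prop :=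
  ∀ u, (T.filter (Γ.src · = u)).card = if u ∈ Z then 0 else 1

/-- The signed adjacency matrix of a set of edges. -/
def signedAdj (ν : E → ℤˣ) (T : Finset E) : Matrix V V ℤ :=
  fun u => ∑ e ∈ T with Γ.src e = u, (ν e : ℤ) • Pi.single (Γ.tgt e) 1

variable [Fintype E] [CommRing R]

/-- The Laplacian of a signed graph. -/
def signedLaplacian (ν : E → ℤˣ) : Matrix V V R :=
  fun u => ∑ e with Γ.src e = u,
    Γ.wt e • (Pi.single u 1 - ((ν e : ℤ) : R) • Pi.single (Γ.tgt e) 1)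

/-- The Laplacian of a signed graph, with the rows of the vertices of `Z` replaced by those of the
unit matrix. -/
def rootedLaplacian (ν : E → ℤˣ) (Z : Finset V) : Matrix V V R :=
  fun u => if u ∈ Z then Pi.single u 1 else Γ.signedLaplacian ν u

theorem rootedLaplacian_empty (ν : E → ℤˣ) : Γ.rootedLaplacian ν ∅ = Γ.signedLaplacian ν := by
  ext
  simp [rootedLaplacian]

theorem rootedLaplacian_singleton (ν : E → ℤˣ) (v : V) :
    Γ.rootedLaplacian ν {v} = (Γ.signedLaplacian ν).updateRow v (Pi.single v 1) := by
  ext u w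
  by_cases h : u = v
  · subst h
    simp [rootedLaplacian]
  · simp [rootedLaplacian, h]

/-- Root rows (empty selection) and ordinary rows (one selected edge) get the same form, so one
multilinear expansion serves both. -/
theorem rootedLaplacian_apply (ν : E → ℤˣ) (Z : Finset V) (u : V) :
    Γ.rootedLaplacian ν Z u =
      ∑ S ∈ (Finset.univ.filter (Γ.src · = u)).powersetCard (if u ∈ Z then 0 else 1),
        (∏ e ∈ S, Γ.wt e) •
          (Pi.single u 1 - ∑ e ∈ S, ((ν e : ℤ) : R) • Pi.single (Γ.tgt e) 1) := by
  by_cases h : u ∈ Z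
  · simp [rootedLaplacian, h]
  · simp [rootedLaplacian, h, Finset.powersetCard_one, signedLaplacian]

variable [Fintype V] [DecidableEq E]

open Classical in
-- Multilinearity selects a set of edges in each row; the union of the selections is a rooted field,
-- and its fibres over the source recover them.
theorem det_rootedLaplacian (ν : E → ℤˣ) (Z : Finset V) :
    (Γ.rootedLaplacian ν Z).det =
      ∑ T with Γ.IsRootedField Z T,
        (∏ e ∈ T, Γ.wt e) * ((1 - Γ.signedAdj ν T).det : ℤ) := by
  have h1 : (Γ.rootedLaplacian ν Z).det = detRowAlternating.toMultilinearMap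
      fun u => ∑ S ∈ (Finset.univ.filter (Γ.src · = u)).powersetCard (if u ∈ Z then 0 else 1),
        (∏ e ∈ S, Γ.wt e) •
          ((Pi.single u 1 - ∑ e ∈ S, ((ν e : ℤ) : R) • Pi.single (Γ.tgt e) 1) : V → R) :=
    congrArg det (funext (Γ.rootedLaplacian_apply ν Z))
  rw [h1, MultilinearMap.map_sum_finset]
  have hmem : ∀ r : V → Finset E, r ∈ (Fintype.piFinset fun u =>
      (Finset.univ.filter (Γ.src · = u)).powersetCard (if u ∈ Z then 0 else 1)) ↔
      ∀ u, (∀ e ∈ r u, Γ.src e = u) ∧ (r u).card = if u ∈ Z then 0 else 1 := by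
    intro r
    simp [Fintype.mem_piFinset, Finset.mem_powersetCard, Finset.subset_iff]
  have hfib : ∀ r : V → Finset E, (∀ u, ∀ e ∈ r u, Γ.src e = u) → ∀ u,
      (Finset.univ.biUnion r).filter (Γ.src · = u) = r u := by
    intro r hr u
    ext e
    simp only [Finset.mem_filter, Finset.mem_biUnion, Finset.mem_univ, true_and]
    constructor
    · rintro ⟨⟨x, hx⟩, rfl⟩
      rwa [← hr x e hx] at hx
    · intro he
      exact ⟨⟨u, he⟩, hr u e he⟩
  refine Finset.sum_nbij' (fun r => Finset.univ.biUnion r)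
    (fun T u => T.filter (Γ.src · = u)) ?_ ?_ ?_ ?_ ?_
  · intro r hr
    rw [hmem] at hr
    rw [Finset.mem_filter]
    refine ⟨Finset.mem_univ _, fun u => ?_⟩
    rw [hfib r (fun u => (hr u).1)]
    exact (hr u).2
  · intro T hT
    rw [hmem]
    exact fun u => ⟨fun e he => (Finset.mem_filter.1 he).2, (Finset.mem_filter.1 hT).2 u⟩
  · intro r hr
    rw [hmem] at hr
    exact funext (hfib r fun u => (hr u).1)
  · intro T _
    ext e
    simp
  · intro r hr
    rw [hmem] at hr
    have hf := hfib r fun u => (hr u).1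
    rw [MultilinearMap.map_smul_univ, smul_eq_mul]
    congr 1
    · rw [← Finset.prod_fiberwise _ Γ.src]
      exact Finset.prod_congr rfl fun u _ => by rw [hf]
    · have h2 : (((1 - Γ.signedAdj ν (Finset.univ.biUnion r)).det : ℤ) : R) =
          ((Int.castRingHom R).mapMatrix (1 - Γ.signedAdj ν (Finset.univ.biUnion r))).det := by
        rw [← RingHom.map_det]
        rfl
      rw [h2]
      refine congrArg det (Matrix.ext fun u w => ?_)
      simp only [RingHom.mapMatrix_apply, Matrix.map_apply, Matrix.sub_apply, signedAdj, hf,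
        Pi.sub_apply, Finset.sum_apply, Pi.smul_apply, smul_eq_mul, map_sub, map_sum, map_mul,
        Pi.single_apply, Matrix.one_apply, eq_comm (a := u)]
      simp

end Expansion

/-! ### Arborescences and the matrix-tree theorem -/

section Arborescence

variable {V E R : Type*} [DecidableEq V] {Γ : WDigraph V E R}

theorem IsRootedField.exists_selfMap {Z : Finset V} {T : Finset E}
    (hT : Γ.IsRootedField Z T) (ν : E → ℤˣ) :
    ∃ (f : V → V) (ε : V → ℤ), (∀ u ∈ Z, ε u = 0) ∧
      (∀ u ∉ Z, ∃ e ∈ T, Γ.src e = u ∧ Γ.tgt e = f u ∧ (ν e : ℤ) = ε u) ∧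
      Γ.signedAdj ν T = ofSelfMap f ε := by
  have : ∀ u, ∃ (x : V) (a : ℤ), (u ∈ Z → a = 0) ∧
      (u ∉ Z → ∃ e ∈ T, Γ.src e = u ∧ Γ.tgt e = x ∧ (ν e : ℤ) = a) ∧
      Γ.signedAdj ν T u = fun w => if x = w then a else 0 := by
    intro u
    have hu := hT u
    by_cases hZ : u ∈ Z
    · rw [if_pos hZ, Finset.card_eq_zero] at hu
      -- No edge of T leaves a root; with weight 0 the image chosen for it is immaterial.
      refine ⟨u, 0, fun _ => rfl, fun h => absurd hZ h, ?_⟩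
      ext w
      simp [signedAdj, hu]
    · rw [if_neg hZ, Finset.card_eq_one] at hu
      obtain ⟨e, he⟩ := hu
      have he' : e ∈ T.filter (Γ.src · = u) := by rw [he]; exact Finset.mem_singleton_self e
      rw [Finset.mem_filter] at he'
      refine ⟨Γ.tgt e, ν e, fun h => absurd h hZ, fun _ => ⟨e, he'.1, he'.2, rfl, rfl⟩, ?_⟩
      ext w
      simp only [signedAdj, he]
      simp [Pi.single_apply, eq_comm]
  choose f ε h1 h2 h3 using this
  exact ⟨f, ε, h1, h2, funext h3⟩

theorem IsRootedField.src_notMem {Z : Finset V} {T : Finset E} (hT : Γ.IsRootedField Z T)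
    {e : E} (he : e ∈ T) : Γ.src e ∉ Z := by
  intro hZ
  have h := hT (Γ.src e)
  rw [if_pos hZ, Finset.card_eq_zero, Finset.filter_eq_empty_iff] at h
  exact h he rfl

theorem IsRootedField.eq_of_src_eq {Z : Finset V} {T : Finset E} (hT : Γ.IsRootedField Z T)
    {e e' : E} (he : e ∈ T) (he' : e' ∈ T) (h : Γ.src e = Γ.src e') : e = e' := by
  have h1 := hT (Γ.src e)
  rw [if_neg (hT.src_notMem he)] at h1
  exact Finset.card_le_one.1 h1.le e (Finset.mem_filter.2 ⟨he, rfl⟩) e'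
    (Finset.mem_filter.2 ⟨he', h.symm⟩)

/-- Uniqueness of walks fixes the outdegrees: an edge leaving v would start a second walk from v to
v, and two edges leaving u would start two walks from u to v. -/
theorem IsArborescence.isRootedField {T : Finset E} {v : V} (hT : Γ.IsArborescence T v) :
    Γ.IsRootedField {v} T := by
  have hv : ∀ e ∈ T, Γ.src e ≠ v := by
    intro e he hev
    obtain ⟨p, ⟨hp, hpT⟩, -⟩ := hT (Γ.tgt e)
    have := (hT v).unique (y₁ := []) (y₂ := e :: p) ⟨rfl, by simp⟩
      ⟨⟨hev, hp⟩, by simpa [he] using hpT⟩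
    simp at this
  intro u
  by_cases hu : u = v
  · rw [if_pos (Finset.mem_singleton.2 hu), Finset.card_eq_zero, Finset.filter_eq_empty_iff]
    rintro e he h
    exact hv e he (h.trans hu)
  · rw [if_neg (by simpa using hu), Finset.card_eq_one]
    obtain ⟨p, ⟨hp, hpT⟩, huniq⟩ := hT u
    match p, hp with
    | [], hp => exact absurd hp hu
    | e :: p, hp =>
      refine ⟨e, ?_⟩
      ext e'
      rw [Finset.mem_filter, Finset.mem_singleton]
      constructor
      · rintro ⟨he', hs⟩
        obtain ⟨q, ⟨hq, hqT⟩, -⟩ := hT (Γ.tgt e')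
        have := huniq (e' :: q) ⟨⟨hs, hq⟩, by simpa [he'] using hqT⟩
        exact (List.cons.inj this).1
      · rintro rfl
        exact ⟨hpT _ (List.mem_cons_self), hp.1⟩

/-- Walks in T follow f and cannot leave v, so a walk to v exists exactly when iteration reaches v,
and it is then automatically unique. -/
theorem IsRootedField.isArborescence_iff {T : Finset E} {v : V} (hT : Γ.IsRootedField {v} T)
    {f : V → V} (hf : ∀ u, u ≠ v → ∃ e ∈ T, Γ.src e = u ∧ Γ.tgt e = f u) :
    Γ.IsArborescence T v ↔ ∀ u, ∃ i, f^[i] u = v := by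
  have hfe : ∀ e ∈ T, f (Γ.src e) = Γ.tgt e := by
    intro e he
    obtain ⟨e', he', hs, ht⟩ := hf (Γ.src e) (by simpa using hT.src_notMem he)
    rw [← ht, hT.eq_of_src_eq he' he hs]
  constructor
  · intro h u
    obtain ⟨p, ⟨hp, hpT⟩, -⟩ := h u
    clear h
    induction p generalizing u with
    | nil => exact ⟨0, hp⟩
    | cons e p ih =>
      obtain ⟨i, hi⟩ := ih _ hp.2 fun x hx => hpT x (List.mem_cons_of_mem _ hx)
      refine ⟨i + 1, ?_⟩
      rw [iterate_succ_apply, ← hp.1, hfe e (hpT e List.mem_cons_self), hi]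
  · intro h u
    apply existsUnique_of_exists_of_unique
    · obtain ⟨i, hi⟩ := h u
      induction i generalizing u with
      | zero => exact ⟨[], hi, by simp⟩
      | succ i ih =>
        by_cases hu : u = v
        · exact ⟨[], hu, by simp⟩
        · obtain ⟨e, he, hs, ht⟩ := hf u hu
          obtain ⟨p, hp, hpT⟩ := ih (f u) (by rwa [iterate_succ_apply] at hi)
          exact ⟨e :: p, ⟨hs, by rwa [ht]⟩, by simpa [he] using hpT⟩
    · rintro p q ⟨hp, hpT⟩ ⟨hq, hqT⟩
      have hroot : ∀ {e : E} {w : V}, e ∈ T → Γ.src e = w → w ≠ v := by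
        rintro e _ he rfl
        simpa using hT.src_notMem he
      clear h
      induction p generalizing u q with
      | nil =>
        cases q with
        | nil => rfl
        | cons e q => exact absurd hp (hroot (hqT e List.mem_cons_self) hq.1)
      | cons e p ih =>
        cases q with
        | nil => exact absurd hq (hroot (hpT e List.mem_cons_self) hp.1)
        | cons e' q =>
          have : e = e' := hT.eq_of_src_eq (hpT e List.mem_cons_self)
            (hqT e' List.mem_cons_self) (hp.1.trans hq.1.symm)
          subst this
          rw [ih (Γ.tgt e) q hp.2 (fun x hx => hpT x (List.mem_cons_of_mem _ hx)) hq.2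
            fun x hx => hqT x (List.mem_cons_of_mem _ hx)]

variable [Fintype V]

open Classical in
theorem IsRootedField.det_one_sub_signedAdj {T : Finset E} {v : V}
    (hT : Γ.IsRootedField {v} T) :
    (1 - Γ.signedAdj 1 T).det = if Γ.IsArborescence T v then 1 else 0 := by
  obtain ⟨f, ε, h0, h1, hadj⟩ := hT.exists_selfMap 1
  rw [hadj, det_one_sub_ofSelfMap_of_root (h0 v (Finset.mem_singleton_self v))]
  · refine if_congr (hT.isArborescence_iff fun u hu => ?_).symm rfl rfl
    obtain ⟨e, he, hs, ht, -⟩ := h1 u (by simpa using hu)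
    exact ⟨e, he, hs, ht⟩
  · intro u hu
    obtain ⟨e, -, -, -, h⟩ := h1 u (by simpa using hu)
    rw [← h]
    rfl

/-- The matrix-tree theorem. -/
theorem det_rootedLaplacian_singleton [Fintype E] [CommRing R] (Γ : WDigraph V E R) (v : V) :
    (Γ.rootedLaplacian 1 {v}).det = Γ.arbSum v := by
  classical
  rw [det_rootedLaplacian, arbSum]
  have h : (Finset.univ.filter fun T => Γ.IsArborescence T v) =
      (Finset.univ.filter fun T => Γ.IsRootedField {v} T).filter fun T =>
        Γ.IsArborescence T v := by
    ext T
    simp only [Finset.mem_filter, Finset.mem_univ, true_and]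
    exact ⟨fun h => ⟨h.isRootedField, h⟩, And.right⟩
  rw [h, Finset.sum_filter _ (s := Finset.univ.filter fun T => Γ.IsRootedField {v} T)]
  refine Finset.sum_congr rfl fun T hT => ?_
  rw [(Finset.mem_filter.1 hT).2.det_one_sub_signedAdj]
  split_ifs <;> simp

end Arborescence

end WDigraph

/-! ### Vector fields, their cycles and signed Laplacians -/

namespace WDigraph

open Matrix Function

section VectorField

variable {V E R : Type*} {Γ : WDigraph V E R}

theorem isRootedField_empty_iff [DecidableEq V] {γ : Finset E} :
    Γ.IsRootedField ∅ γ ↔ Γ.IsVectorField γ := by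
  refine forall_congr' fun u => ?_
  rw [if_neg (Finset.notMem_empty u), Finset.card_eq_one, Finset.singleton_iff_unique_mem]
  simp only [Finset.mem_filter]

theorem IsVectorField.exists_section {γ : Finset E} (hγ : Γ.IsVectorField γ) :
    ∃ s : V → E, (∀ u, Γ.src (s u) = u) ∧ ∀ e, e ∈ γ ↔ s (Γ.src e) = e := by
  choose s hs huniq using hγ
  refine ⟨s, fun u => (hs u).2, fun e => ⟨fun he => (huniq _ e ⟨he, rfl⟩).symm, fun he => ?_⟩⟩
  rw [← he]
  exact (hs _).1

/-- A vector field leaves no choice: a walk in it is determined by its start and length. -/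
theorem isWalk_iff_of_section {γ : Finset E} {s : V → E} (hs : ∀ u, Γ.src (s u) = u)
    (hγ : ∀ e, e ∈ γ ↔ s (Γ.src e) = e) {u w : V} {p : List E} :
    (Γ.IsWalk u p w ∧ ∀ e ∈ p, e ∈ γ) ↔
      p = (List.range p.length).map (fun i => s ((Γ.tgt ∘ s)^[i] u)) ∧
        (Γ.tgt ∘ s)^[p.length] u = w := by
  induction p generalizing u with
  | nil => simp [IsWalk]
  | cons e p ih =>
    have h1 : (List.range (e :: p).length).map (fun i => s ((Γ.tgt ∘ s)^[i] u)) =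
        s u :: (List.range p.length).map (fun i => s ((Γ.tgt ∘ s)^[i] (Γ.tgt (s u)))) := by
      rw [List.length_cons, List.range_succ_eq_map, List.map_cons, List.map_map]
      rfl
    rw [h1, List.cons.injEq, List.length_cons, iterate_succ_apply, List.forall_mem_cons]
    constructor
    · rintro ⟨⟨rfl, hp⟩, he, hpγ⟩
      rw [hγ] at he
      have h2 := ih.1 ⟨hp, hpγ⟩
      rw [Function.comp_apply, he]
      exact ⟨⟨rfl, h2.1⟩, h2.2⟩
    · rintro ⟨⟨rfl, h2⟩, h3⟩
      have h4 := ih.2 ⟨h2, h3⟩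
      exact ⟨⟨hs u, h4.1⟩, (hγ _).2 (by rw [hs]), h4.2⟩

variable [DecidableEq V]

theorem signedAdj_eq_of_section {γ : Finset E} {s : V → E} (hs : ∀ u, Γ.src (s u) = u)
    (hγ : ∀ e, e ∈ γ ↔ s (Γ.src e) = e) (ν : E → ℤˣ) :
    Γ.signedAdj ν γ = ofSelfMap (Γ.tgt ∘ s) (fun u => (ν (s u) : ℤ)) := by
  ext u w
  have : γ.filter (Γ.src · = u) = {s u} := by
    ext e
    rw [Finset.mem_filter, hγ, Finset.mem_singleton]
    constructor
    · rintro ⟨h, rfl⟩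
      exact h.symm
    · rintro rfl
      simp [hs]
  simp only [signedAdj, this]
  simp [ofSelfMap, Pi.single_apply, eq_comm]

variable [DecidableEq E]

theorem cycles_eq_of_section [Fintype V] {γ : Finset E} {s : V → E} (hs : ∀ u, Γ.src (s u) = u)
    (hγ : ∀ e, e ∈ γ ↔ s (Γ.src e) = e) :
    Γ.cycles γ = (periodicOrbits (Γ.tgt ∘ s)).image (Finset.image s) := by
  set f := Γ.tgt ∘ s with hf
  ext c
  simp only [cycles, Finset.mem_filter, Finset.mem_powerset, Finset.mem_image,
    mem_periodicOrbits]
  constructor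
  · rintro ⟨hc, u, p, hp0, hp, hnd, hcp⟩
    obtain ⟨h1, h2⟩ := (isWalk_iff_of_section hs hγ).1 ⟨hp, fun e he => hc ((hcp e).2 he)⟩
    rw [← hf] at h1 h2
    have hlen : 0 < p.length := List.length_pos_iff.2 hp0
    have hu : u ∈ periodicPts f := ⟨p.length, hlen, h2⟩
    have hmin : minimalPeriod f u = p.length := by
      apply le_antisymm (IsPeriodicPt.minimalPeriod_le hlen h2)
      -- Otherwise u is the source of the edges at positions 0 and `minimalPeriod f u`, a repeated
      -- vertex.
      by_contra! hlt
      rw [h1, List.map_map] at hnd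
      have := List.inj_on_of_nodup_map hnd (List.mem_range.2 hlt) (List.mem_range.2 hlen)
        (by simp [hs, iterate_minimalPeriod])
      exact (minimalPeriod_pos_of_mem_periodicPts hu).ne' this
    refine ⟨_, ⟨u, hu, rfl⟩, ?_⟩
    ext e
    rw [hcp, h1]
    simp [orbitFinset, hmin]
  · rintro ⟨_, ⟨u, hu, rfl⟩, rfl⟩
    set p := (List.range (minimalPeriod f u)).map fun i => s (f^[i] u) with hp
    have hlen : p.length = minimalPeriod f u := by simp [hp]
    obtain ⟨h1, h2⟩ := (isWalk_iff_of_section (u := u) (w := u) (p := p) hs hγ).2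
      (by rw [hlen, ← hf]; exact ⟨hp, iterate_minimalPeriod⟩)
    have hmem : ∀ e, e ∈ (orbitFinset f u).image s ↔ e ∈ p := by
      intro e
      simp [orbitFinset, hp]
    refine ⟨fun e he => h2 e ((hmem e).1 he), u, p, ?_, h1, ?_, hmem⟩
    · rw [← List.length_pos_iff, hlen]
      exact minimalPeriod_pos_of_mem_periodicPts hu
    · rw [hp, List.map_map]
      refine List.Nodup.map_on ?_ List.nodup_range
      intro i hi j hj hij
      simp only [Function.comp_apply, hs] at hij
      exact iterate_injOn_Iio_minimalPeriod (List.mem_range.1 hi) (List.mem_range.1 hj) hij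

theorem IsVectorField.cycles_nonempty [Fintype V] [Nonempty V] {γ : Finset E}
    (hγ : Γ.IsVectorField γ) : (Γ.cycles γ).Nonempty := by
  obtain ⟨s, hs, hsγ⟩ := hγ.exists_section
  rw [cycles_eq_of_section hs hsγ]
  exact (periodicOrbits_nonempty _).image _

open Classical in
theorem IsVectorField.det_one_sub_signedAdj [Fintype V] {γ : Finset E} (hγ : Γ.IsVectorField γ)
    (ν : E → ℤˣ) : (1 - Γ.signedAdj ν γ).det =
      if ∀ c ∈ Γ.cycles γ, ∏ e ∈ c, ν e = -1 then 2 ^ (Γ.cycles γ).card else 0 := by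
  obtain ⟨s, hs, hsγ⟩ := hγ.exists_section
  have hinj : Injective s := LeftInverse.injective hs
  rw [signedAdj_eq_of_section hs hsγ, det_one_sub_ofSelfMap_of_sign, cycles_eq_of_section hs hsγ,
    Finset.card_image_of_injective _ (Finset.image_injective hinj)]
  · refine if_congr ?_ rfl rfl
    rw [Finset.forall_mem_image]
    refine forall₂_congr fun c _ => ?_
    rw [Finset.prod_image hinj.injOn, Units.ext_iff]
    simp
  · intro u
    rcases Int.units_eq_one_or (ν (s u)) with h | h <;> simp [h]

/-- The determinant of the Laplacian of a signed graph. -/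
theorem det_signedLaplacian [Fintype V] [Nonempty V] [Fintype E] [CommRing R]
    (Γ : WDigraph V E R) (ν : E → ℤˣ) :
    (Γ.signedLaplacian ν).det = 2 * ∑ γ ∈ Γ.negativeVectorFields ν,
      2 ^ ((Γ.cycles γ).card - 1) * ∏ e ∈ γ, Γ.wt e := by
  classical
  rw [← rootedLaplacian_empty, det_rootedLaplacian, negativeVectorFields, Finset.mul_sum]
  have h : (Finset.univ.filter fun γ => Γ.IsNegativeVectorField ν γ) =
      (Finset.univ.filter fun γ => Γ.IsRootedField ∅ γ).filter fun γ =>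
        ∀ c ∈ Γ.cycles γ, ∏ e ∈ c, ν e = -1 := by
    ext γ
    rw [Finset.mem_filter, Finset.mem_filter, Finset.mem_filter, isRootedField_empty_iff]
    simp only [IsNegativeVectorField, Finset.mem_univ, true_and]
  rw [h, Finset.sum_filter _ (s := Finset.univ.filter fun γ => Γ.IsRootedField ∅ γ)]
  refine Finset.sum_congr rfl fun γ hγ => ?_
  have hγ' := isRootedField_empty_iff.1 (Finset.mem_filter.1 hγ).2
  rw [hγ'.det_one_sub_signedAdj]
  -- A vector field has at least one cycle, so the subtraction in the exponent is not truncated and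
  -- a factor 2 splits off.
  obtain ⟨k, hk⟩ := Nat.exists_eq_succ_of_ne_zero hγ'.cycles_nonempty.card_pos.ne'
  rw [hk]
  split_ifs
  · push_cast
    rw [pow_succ]
    ring
  · simp

end VectorField

end WDigraph

/-! ### Block determinants and diagonal perturbations -/

namespace Matrix

variable {V R : Type*} [Fintype V] [DecidableEq V] [CommRing R]

/-- Subtracting the first block row from the second and adding the second block column to the first
gives a triangular matrix, without inverting 2. -/
theorem det_fromBlocks_swap (A B : Matrix V V R) :
    (fromBlocks A B B A).det = (A + B).det * (A - B).det := by
  have h : fromBlocks 1 0 (-1) 1 * fromBlocks A B B A * fromBlocks 1 0 1 1 =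
      fromBlocks (A + B) B 0 (A - B) := by
    simp only [fromBlocks_multiply]
    congr 1 <;> simp [sub_eq_add_neg]; abel
  have h' := congrArg det h
  simpa [det_mul, det_fromBlocks_zero₂₁, det_fromBlocks_zero₁₂] using h'

theorem det_of_units_int_symm {M : Matrix (V × ℤˣ) (V × ℤˣ) R} {A B : Matrix V V R}
    (hA : ∀ u w h, M (u, h) (w, h) = A u w) (hB : ∀ u w h, M (u, h) (w, -h) = B u w) :
    M.det = (A + B).det * (A - B).det := by
  have hbij : Function.Bijective
      (Sum.elim (fun u => (u, 1)) (fun u => (u, -1)) : V ⊕ V → V × ℤˣ) := by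
    constructor
    · rintro (u | u) (w | w) h
      all_goals simp at h
      · rw [h]
      · rw [h]
    · rintro ⟨u, h⟩
      rcases Int.units_eq_one_or h with rfl | rfl
      · exact ⟨Sum.inl u, rfl⟩
      · exact ⟨Sum.inr u, rfl⟩
  rw [← det_fromBlocks_swap, ← det_submatrix_equiv_self (Equiv.ofBijective _ hbij) M]
  congr 1
  ext (u | u) (w | w)
  · exact hA u w 1
  · exact hB u w 1
  · simpa using hB u w (-1)
  · exact hA u w (-1)

theorem det_add_diagonal_single (M : Matrix V V R) (v : V) (t : R) :
    (M + diagonal (Pi.single v t)).det = M.det + t * (M.updateRow v (Pi.single v 1)).det := by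
  have : M + diagonal (Pi.single v t) = M.updateRow v (M v + t • Pi.single v 1) := by
    ext u w
    by_cases h : u = v
    · subst h
      by_cases hw : w = u
      · subst hw; simp
      · simp [hw, diagonal_apply_ne _ (Ne.symm hw)]
    · by_cases hw : u = w
      · subst hw; simp [h]
      · simp [h, diagonal_apply_ne _ hw]
  rw [this, det_updateRow_add, det_updateRow_smul, updateRow_eq_self]

/-- Isolates the coefficient of t; the coefficient of t² may stay unnamed. -/
theorem det_add_diagonal_single_add_single (M : Matrix V V R) {v w : V} (hvw : v ≠ w) :
    ∃ x, ∀ t, (M + diagonal (Pi.single v t) + diagonal (Pi.single w t)).det =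
      M.det + t * ((M.updateRow v (Pi.single v 1)).det + (M.updateRow w (Pi.single w 1)).det) +
        t ^ 2 * x := by
  refine ⟨((M.updateRow w (Pi.single w 1)).updateRow v (Pi.single v 1)).det, fun t => ?_⟩
  have : (M + diagonal (Pi.single v t)).updateRow w (Pi.single w 1) =
      M.updateRow w (Pi.single w 1) + diagonal (Pi.single v t) := by
    ext x y
    by_cases hx : x = w
    · subst hx
      by_cases hy : x = y
      · subst hy; simp [hvw.symm]
      · simp [diagonal_apply_ne _ hy]
    · simp [hx]
  rw [det_add_diagonal_single, det_add_diagonal_single, this, det_add_diagonal_single]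
  ring

end Matrix

/-! ### The Laplacian of the derived graph -/

namespace WDigraph

open Matrix

section Derived

variable {V E R : Type*} [DecidableEq V] [Fintype E] [CommRing R]

theorem signedLaplacian_apply (Γ : WDigraph V E R) (ν : E → ℤˣ) (u w : V) :
    Γ.signedLaplacian ν u w = ∑ e with Γ.src e = u,
      Γ.wt e * ((if u = w then 1 else 0) - ((ν e : ℤ) : R) * if Γ.tgt e = w then 1 else 0) := by
  simp only [signedLaplacian, Finset.sum_apply, Pi.smul_apply, Pi.sub_apply, smul_eq_mul,
    Pi.single_apply, eq_comm (a := w)]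

theorem derived_signedLaplacian_apply (Γ : WDigraph V E R) (ν : E → ℤˣ) (u w : V) (h k : ℤˣ) :
    (Γ.derived ν).signedLaplacian 1 (u, h) (w, k) = ∑ e with Γ.src e = u,
      Γ.wt e * ((if u = w ∧ h = k then 1 else 0) -
        if Γ.tgt e = w ∧ ν e * h = k then 1 else 0) := by
  rw [signedLaplacian_apply]
  refine Finset.sum_nbij' (fun x => x.1) (fun e => (e, h)) ?_ ?_ ?_ ?_ ?_
  · rintro ⟨e, k⟩ he
    simp_all [derived]
  · intro e he
    simp_all [derived]
  · rintro ⟨e, k⟩ he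
    simp_all [derived]
  · intro e he
    rfl
  · rintro ⟨e, k⟩ he
    simp_all [derived]

variable [Fintype V]

/-- Edges of voltage 1 stay in their sheet and contribute to A; those of voltage -1 change sheets
and contribute to B. The sum forgets the voltage, the difference keeps it as a sign, and t lies in
A. -/
theorem det_derived_signedLaplacian_add (Γ : WDigraph V E R) (ν : E → ℤˣ) (v : V) (t : R) :
    ((Γ.derived ν).signedLaplacian 1 + diagonal (Pi.single (v, 1) t) +
        diagonal (Pi.single (v, -1) t)).det =
      (Γ.signedLaplacian 1 + diagonal (Pi.single v t)).det *
        (Γ.signedLaplacian ν + diagonal (Pi.single v t)).det := by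
  have hne : ∀ h : ℤˣ, h ≠ -h := by decide
  rw [det_of_units_int_symm
    (A := Matrix.of fun u w => ∑ e with Γ.src e = u, Γ.wt e * ((if u = w then 1 else 0) -
        if Γ.tgt e = w ∧ ν e = 1 then 1 else 0) + diagonal (Pi.single v t) u w)
    (B := Matrix.of fun u w => ∑ e with Γ.src e = u, Γ.wt e * (0 -
        if Γ.tgt e = w ∧ ν e = -1 then 1 else 0))]
  · congr 2
    · ext u w
      rw [Matrix.add_apply, Matrix.add_apply, of_apply, of_apply, add_right_comm, signedLaplacian_apply,
        ← Finset.sum_add_distrib]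
      congr 1
      refine Finset.sum_congr rfl fun e _ => ?_
      rcases Int.units_eq_one_or (ν e) with h | h <;> by_cases hw : Γ.tgt e = w <;>
        by_cases hu : u = w <;> simp [h, hw, hu]
    · ext u w
      rw [Matrix.sub_apply, Matrix.add_apply, of_apply, of_apply, add_sub_right_comm, signedLaplacian_apply,
        ← Finset.sum_sub_distrib]
      congr 1
      refine Finset.sum_congr rfl fun e _ => ?_
      rcases Int.units_eq_one_or (ν e) with h | h <;> by_cases hw : Γ.tgt e = w <;>
        by_cases hu : u = w <;> simp [h, hw, hu]; ring
  · intro u w h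
    rw [Matrix.add_apply, Matrix.add_apply, derived_signedLaplacian_apply, of_apply, add_assoc]
    congr 1
    · simp
    · by_cases hu : u = w
      · subst hu
        by_cases hv : u = v
        · subst hv
          rcases Int.units_eq_one_or h with rfl | rfl <;> simp
        · simp [hv]
      · simp [diagonal_apply_ne, hu]
  · intro u w h
    rw [Matrix.add_apply, Matrix.add_apply, derived_signedLaplacian_apply,
      diagonal_apply_ne _ (by simp [hne]), diagonal_apply_ne _ (by simp [hne]), of_apply, add_zero, add_zero]
    refine Finset.sum_congr rfl fun e _ => ?_
    rcases Int.units_eq_one_or (ν e) with h' | h' <;> simp [h', hne]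

/-- By the matrix-tree theorem it is enough to reindex a determinant; no arborescence has to be
transported. -/
theorem arbSum_of_equiv {V' E' : Type*} [Finite V'] [Fintype E'] {Γ' : WDigraph V' E' R}
    {Γ : WDigraph V E R} (f : V' ≃ V) (g : E' ≃ E) (hsrc : ∀ e, Γ.src (g e) = f (Γ'.src e))
    (htgt : ∀ e, Γ.tgt (g e) = f (Γ'.tgt e)) (hwt : ∀ e, Γ.wt (g e) = Γ'.wt e) (x : V') :
    Γ'.arbSum x = Γ.arbSum (f x) := by
  classical
  have := Fintype.ofFinite V'
  rw [← det_rootedLaplacian_singleton, ← det_rootedLaplacian_singleton,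
    ← det_submatrix_equiv_self f]
  congr 1
  ext u w
  simp only [rootedLaplacian, submatrix_apply, Finset.mem_singleton, f.injective.eq_iff]
  split_ifs
  · simp [Pi.single_apply, f.injective.eq_iff]
  · rw [signedLaplacian_apply, signedLaplacian_apply]
    refine Finset.sum_equiv g (fun e => ?_) fun e _ => ?_
    · simp [hsrc, f.injective.eq_iff]
    · simp [hwt, htgt, f.injective.eq_iff]

/-- Voltages multiply on the left, so right multiplication is an automorphism and exchanges the
lifts. -/
theorem derived_arbSum_eq (Γ : WDigraph V E R) (ν : E → ℤˣ) (v : V) (h k : ℤˣ) :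
    (Γ.derived ν).arbSum (v, h) = (Γ.derived ν).arbSum (v, k) := by
  rw [arbSum_of_equiv (Γ := Γ.derived ν) ((Equiv.refl V).prodCongr (Equiv.mulRight (h⁻¹ * k)))
    ((Equiv.refl E).prodCongr (Equiv.mulRight (h⁻¹ * k)))]
  · simp [← mul_assoc]
  · simp [derived]
  · simp [derived, mul_assoc]
  · simp [derived]

/-- Without signs the Laplacian is singular, since no vector field is negative. -/
theorem det_signedLaplacian_one [Nonempty V] (Γ : WDigraph V E R) :
    (Γ.signedLaplacian 1).det = 0 := by
  classical
  rw [det_signedLaplacian, Finset.sum_eq_zero, mul_zero]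
  intro γ hγ
  obtain ⟨hvf, hneg⟩ := (Finset.mem_filter.1 hγ).2
  obtain ⟨c, hc⟩ := hvf.cycles_nonempty
  have := hneg c hc
  simp [← Units.val_inj] at this

theorem arbSum_derived [IsDomain R] [CharZero R] (Γ : WDigraph V E R) (ν : E → ℤˣ) (v : V)
    (h : ℤˣ) :
    (Γ.derived ν).arbSum (v, h) = (∑ γ ∈ Γ.negativeVectorFields ν,
      2 ^ ((Γ.cycles γ).card - 1) * ∏ e ∈ γ, Γ.wt e) * Γ.arbSum v := by
  classical
  have : Nonempty V := ⟨v⟩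
  have hne : ((v, 1) : V × ℤˣ) ≠ (v, -1) := by simp
  obtain ⟨x, hx⟩ := det_add_diagonal_single_add_single ((Γ.derived ν).signedLaplacian 1) hne
  have hx' : ∀ t : R, _ := fun t => (hx t).symm.trans (det_derived_signedLaplacian_add Γ ν v t)
  simp only [det_add_diagonal_single, ← rootedLaplacian_singleton, det_rootedLaplacian_singleton,
    det_signedLaplacian_one, derived_arbSum_eq Γ ν v _ h] at hx'
  -- Subtracting the values at t = 1 and t = -1 cancels the even terms and doubles the coefficient
  -- of t, in which each side already carries a 2; hence the factor 4.
  have h1 := hx' 1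
  have h2 := hx' (-1)
  rw [det_signedLaplacian Γ ν] at h1 h2
  have h4 : (4 : R) ≠ 0 := by norm_num
  apply mul_left_cancel₀ h4
  linear_combination h1 - h2

end Derived

end WDigraph

/-! ### Signings of a 2-fold cover and switching -/

namespace WDigraph

open Matrix

/-- Switching conjugates the Laplacian by the diagonal matrix of η, which is its own inverse. -/
theorem det_signedLaplacian_of_switching {V E R : Type*} [Fintype V] [DecidableEq V] [Fintype E]
    [CommRing R] (Γ : WDigraph V E R) {ν ν' : E → ℤˣ} (η : V → ℤˣ)
    (h : ∀ e, ν' e = η (Γ.tgt e) * ν e * η (Γ.src e)) :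
    (Γ.signedLaplacian ν').det = (Γ.signedLaplacian ν).det := by
  set D : Matrix V V R := diagonal fun u => ((η u : ℤ) : R)
  have hsq : ∀ u, ((η u : ℤ) : R) * ((η u : ℤ) : R) = 1 := by
    intro u
    rcases Int.units_eq_one_or (η u) with h | h <;> simp [h]
  have hD : Γ.signedLaplacian ν' = D * Γ.signedLaplacian ν * D := by
    ext u w
    rw [mul_diagonal, diagonal_mul, signedLaplacian_apply, signedLaplacian_apply, Finset.mul_sum,
      Finset.sum_mul]
    refine Finset.sum_congr rfl fun e he => ?_
    obtain rfl := (Finset.mem_filter.1 he).2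
    rw [h]
    push_cast
    have h1 : (if Γ.src e = w then (1 : R) else 0) =
        ((η (Γ.src e) : ℤ) : R) * (if Γ.src e = w then 1 else 0) * ((η w : ℤ) : R) := by
      split_ifs with hw
      · rw [← hw, mul_one, hsq]
      · simp
    have h2 : ((η (Γ.tgt e) : ℤ) : R) * (if Γ.tgt e = w then 1 else 0) =
        (if Γ.tgt e = w then 1 else 0) * ((η w : ℤ) : R) := by
      split_ifs with hw
      · rw [hw, mul_one, one_mul]
      · simp
    linear_combination Γ.wt e * h1 -
      Γ.wt e * ((ν e : ℤ) : R) * ((η (Γ.src e) : ℤ) : R) * h2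
  have hdet : D.det * D.det = 1 := by
    rw [← det_mul, diagonal_mul_diagonal]
    simp [hsq]
  rw [hD, det_mul, det_mul, mul_right_comm, hdet, one_mul]

namespace Covering

variable {V E V' E' R : Type*} {Γ' : WDigraph V' E' R} {Γ : WDigraph V E R} (π : Covering Γ' Γ)

/-- A `2`-fold cover is derived from a signing. -/
theorem exists_isDerivedFrom (h2 : ∀ v, (π.onV ⁻¹' {v}).encard = 2) :
    ∃ ν : E → ℤˣ, π.IsDerivedFrom ν := by
  classical
  simp only [Set.encard_eq_two] at h2
  choose a b hab hfib using h2
  have hV : ∀ x, x = a (π.onV x) ∨ x = b (π.onV x) := by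
    intro x
    have : x ∈ π.onV ⁻¹' {π.onV x} := rfl
    rwa [hfib] at this
  have ha : ∀ v, π.onV (a v) = v := by
    intro v
    have : a v ∈ π.onV ⁻¹' {v} := by rw [hfib]; exact Or.inl rfl
    exact this
  have hb : ∀ v, π.onV (b v) = v := by
    intro v
    have : b v ∈ π.onV ⁻¹' {v} := by rw [hfib]; exact Or.inr rfl
    exact this
  obtain ⟨f, hf⟩ : ∃ f : V' ≃ V × ℤˣ, ∀ x, (f x).1 = π.onV x := by
    refine ⟨⟨fun x => (π.onV x, if x = a (π.onV x) then 1 else -1),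
      fun y => if y.2 = 1 then a y.1 else b y.1, ?_, ?_⟩, fun x => rfl⟩
    · intro x
      by_cases h : x = a (π.onV x)
      · simp only [if_pos h, if_true]
        exact h.symm
      · simp only [if_neg h]
        rw [if_neg (by decide)]
        exact ((hV x).resolve_left h).symm
    · rintro ⟨v, h⟩
      rcases Int.units_eq_one_or h with rfl | rfl
      · simp [ha]
      · have : (-1 : ℤˣ) ≠ 1 := by decide
        simp [this, hb, (hab v).symm]
  have hinj : ∀ {x y}, π.onV x = π.onV y → (f x).2 = (f y).2 → x = y := fun h1 h2 =>
    f.injective (Prod.ext (by rw [hf, hf, h1]) h2)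
  have hbij : Function.Bijective fun e => (π.onE e, (f (Γ'.src e)).2) := by
    constructor
    · intro e e' h
      obtain ⟨h1, h2⟩ := Prod.ext_iff.1 h
      have h3 : Γ'.src e = Γ'.src e' := by
        refine hinj ?_ h2
        rw [← π.src_onE, ← π.src_onE]
        exact congrArg Γ.src h1
      exact (π.bijOn_src _).injOn h3 rfl h1
    · rintro ⟨e, h⟩
      have h1 : π.onV (f.symm (Γ.src e, h)) = Γ.src e := by rw [← hf, Equiv.apply_symm_apply]
      obtain ⟨e', he', rfl⟩ := (π.bijOn_src (f.symm (Γ.src e, h))).surjOn h1.symm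
      refine ⟨e', Prod.ext rfl ?_⟩
      have h2 : Γ'.src e' = _ := he'
      change (f (Γ'.src e')).2 = h
      rw [h2, Equiv.apply_symm_apply]
  set g := Equiv.ofBijective _ hbij with hg
  have hg1 : ∀ e, (g e).1 = π.onE e := fun e => rfl
  have hg2 : ∀ e, (g e).2 = (f (Γ'.src e)).2 := fun e => rfl
  -- The voltage of an edge is the sheet where its lift starting in sheet 1 ends.
  refine ⟨fun e => (f (Γ'.tgt (g.symm (e, 1)))).2, f, g, hf, hg1, ?_, ?_⟩
  · intro e
    exact Prod.ext (by rw [hf, ← π.src_onE]; rfl) rfl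
  · intro e
    refine Prod.ext (by rw [hf, ← π.tgt_onE]; rfl) ?_
    change (f (Γ'.tgt (g.symm (π.onE e, 1)))).2 * (f (Γ'.src e)).2 = _
    rcases Int.units_eq_one_or (f (Γ'.src e)).2 with h | h
    · have : g.symm (π.onE e, 1) = e := by
        rw [Equiv.symm_apply_eq, ← h]
        rfl
      rw [this, h, mul_one]
    · obtain ⟨e₀, he₀⟩ : ∃ e₀, e₀ = g.symm (π.onE e, 1) := ⟨_, rfl⟩
      have he₁ : g e₀ = (π.onE e, 1) := by rw [he₀, Equiv.apply_symm_apply]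
      have hE : π.onE e₀ = π.onE e := by rw [← hg1, he₁]
      have hne : e₀ ≠ e := by
        rintro rfl
        rw [← hg2, he₁] at h
        have : (1 : ℤˣ) ≠ -1 := by decide
        exact this h
      have htgt : (f (Γ'.tgt e)).2 ≠ (f (Γ'.tgt e₀)).2 := by
        intro h'
        have h3 : Γ'.tgt e = Γ'.tgt e₀ := hinj (by rw [← π.tgt_onE, ← π.tgt_onE, hE]) h'
        exact hne ((π.bijOn_tgt _).injOn h3 rfl hE.symm).symm
      rw [← he₀, h, mul_neg, mul_one, Int.units_ne_iff_eq_neg.1 htgt]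

variable {π}

/-- Two signings of the same cover differ by switching. -/
theorem IsDerivedFrom.exists_switching {ν ν' : E → ℤˣ} (h : π.IsDerivedFrom ν)
    (h' : π.IsDerivedFrom ν') :
    ∃ η : V → ℤˣ, ∀ e, ν' e = η (Γ.tgt e) * ν e * η (Γ.src e) := by
  obtain ⟨f, g, hf, hg, hs, ht⟩ := h
  obtain ⟨f', g', hf', hg', hs', ht'⟩ := h'
  -- A bijection between two-element fibres labelled by signs is multiplication by a sign, here the
  -- `f'`-label of the point that `f` labels 1.
  have hη : ∀ x, (f' x).2 = (f' (f.symm ((f x).1, 1))).2 * (f x).2 := by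
    intro x
    rcases Int.units_eq_one_or (f x).2 with h | h
    · have : ((f x).1, (1 : ℤˣ)) = f x := Prod.ext rfl h.symm
      rw [this, h, Equiv.symm_apply_apply, mul_one]
    · rw [h, mul_neg, mul_one, ← Int.units_ne_iff_eq_neg]
      intro h1
      have h2 : x = f.symm ((f x).1, 1) := by
        refine f'.injective (Prod.ext ?_ h1)
        rw [hf', hf', ← hf, ← hf, Equiv.apply_symm_apply]
      have h3 := congrArg (fun y => (f y).2) h2
      simp only [Equiv.apply_symm_apply, h] at h3
      exact absurd h3 (by decide)
  refine ⟨fun u => (f' (f.symm (u, 1))).2, fun e => ?_⟩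
  obtain ⟨e', he'⟩ := g.surjective (e, 1)
  have hE : π.onE e' = e := by rw [← hg, he']
  have hE' : (g' e').1 = e := by rw [hg', hE]
  have h1 : f (Γ'.src e') = (Γ.src e, 1) := by rw [← hs, he']; rfl
  have h2 : f (Γ'.tgt e') = (Γ.tgt e, ν e) := by rw [← ht, he']; exact Prod.ext rfl (mul_one _)
  have h3 := hη (Γ'.tgt e')
  have h4 : (f' (Γ'.src e')).2 = (f' (f.symm (Γ.src e, 1))).2 := by
    rw [← h1, Equiv.symm_apply_apply]
  have h5 : (f' (Γ'.tgt e')).2 = ν' e * (f' (Γ'.src e')).2 := by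
    rw [← ht', ← hs', ← hE']
    rfl
  rw [h2] at h3
  beta_reduce
  rw [← h3, ← h4, h5, mul_assoc, Int.units_mul_self, mul_one]

theorem IsDerivedFrom.arbSum_eq [Finite V'] [Fintype E'] [Fintype V] [Fintype E] [CommRing R]
    [IsDomain R] [CharZero R] {ν : E → ℤˣ} (h : π.IsDerivedFrom ν) (x : V') :
    Γ'.arbSum x = (∑ γ ∈ Γ.negativeVectorFields ν,
      2 ^ ((Γ.cycles γ).card - 1) * ∏ e ∈ γ, Γ.wt e) * Γ.arbSum (π.onV x) := by
  classical
  obtain ⟨f, g, hf, hg, hs, ht⟩ := h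
  rw [arbSum_of_equiv (Γ := Γ.derived ν) f g hs ht (fun e => ?_), ← hf, ← arbSum_derived]
  rw [π.wt_onE, ← hg]
  rfl

end Covering

end WDigraph

/-! ### Positivity and conclusion -/

theorem MvPolynomial.coeff_sum_mul_prod_X_nonneg {E ι : Type*} (s : Finset ι) (k : ι → ℕ)
    (t : ι → Finset E) (m : E →₀ ℕ) :
    0 ≤ (∑ i ∈ s, 2 ^ k i * ∏ e ∈ t i, (X e : MvPolynomial E ℤ)).coeff m := by
  classical
  rw [coeff_sum]
  refine Finset.sum_nonneg fun i _ => ?_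
  have : (2 ^ k i * ∏ e ∈ t i, X e : MvPolynomial E ℤ) =
      monomial (∑ e ∈ t i, Finsupp.single e 1) (2 ^ k i) := by
    rw [← mul_one ((2 : ℤ) ^ k i), ← C_mul_monomial, monomial_sum_one]
    simp [X]
  rw [this, coeff_monomial]
  split_ifs <;> positivity

theorem corollary4p5 {V E V' E' : Type*} [Fintype V] [Fintype E] [Fintype V'] [Fintype E']
    (Γ : WDigraph V E (MvPolynomial E ℤ)) (hΓ : ∀ e, Γ.wt e = MvPolynomial.X e)
    (Γ' : WDigraph V' E' (MvPolynomial E ℤ)) (π : WDigraph.Covering Γ' Γ)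
    (hfold : π.IsFold 2) (hreg : π.IsRegular) (v' : V') :
    ∃ P : MvPolynomial E ℤ,
      -- `P` is the ratio (the product form makes sense also when `A_v(Γ) = 0`)
      Γ'.arbSum v' = P * Γ.arbSum (π.onV v') ∧
      (Γ.arbSum (π.onV v') ≠ 0 →
        algebraMap (MvPolynomial E ℤ) (FractionRing (MvPolynomial E ℤ)) (Γ'.arbSum v') /
          algebraMap (MvPolynomial E ℤ) (FractionRing (MvPolynomial E ℤ)) (Γ.arbSum (π.onV v')) =
        algebraMap (MvPolynomial E ℤ) (FractionRing (MvPolynomial E ℤ)) P) ∧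
      -- all coefficients that occur in `P` are positive
      (∀ m ∈ P.support, 0 < P.coeff m) ∧
      -- the cover is derived from some signing of `Γ`, and each such signing computes `P`
      (∃ ν : E → ℤˣ, π.IsDerivedFrom ν) ∧
      ∀ ν : E → ℤˣ, π.IsDerivedFrom ν →
        P = ∑ γ ∈ Γ.negativeVectorFields ν,
          2 ^ ((Γ.cycles γ).card - 1) * ∏ e ∈ γ, Γ.wt e := by
  classical
  obtain ⟨ν, hν⟩ := π.exists_isDerivedFrom hfold.1
  have : Nonempty V := ⟨π.onV v'⟩
  have hmul := hν.arbSum_eq v'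
  refine ⟨_, hmul, fun h0 => ?_, fun m hm => ?_, ⟨ν, hν⟩, fun ν' hν' => ?_⟩
  · rw [hmul, map_mul, mul_div_cancel_right₀]
    rwa [Ne, FaithfulSMul.algebraMap_eq_zero_iff]
  · refine lt_of_le_of_ne ?_ (Ne.symm (MvPolynomial.mem_support_iff.1 hm))
    simp only [hΓ]
    exact MvPolynomial.coeff_sum_mul_prod_X_nonneg _ _ _ m
  -- The determinants 2P are compared, not the products P · A_v, since A_v may vanish.
  · obtain ⟨η, hη⟩ := hν.exists_switching hν'
    have h := Γ.det_signedLaplacian_of_switching η hη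
    rw [WDigraph.det_signedLaplacian, WDigraph.det_signedLaplacian] at h
    exact (mul_left_cancel₀ two_ne_zero h).symm
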